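/- Let $|\cdot|$ be the Euclidean norm, let $S=(S_n)_{n\ge 0}$ be the simple random walk on $\mathbb Z^2$, and let $\mathbb P_x,\mathbb E_x$ denote probability and expectation for a process started at $x$. Let $$a(x)=\lim_{N\to\infty}\sum_{n=0}^{N-1}\big(\mathbb P_0[S_n=0]-\mathbb P_0[S_n=x]\big),\qquad x\in\mathbb Z^2,$$ be its potential kernel, and let $\widehat S$ be the Markov chain on $\mathbb Z^2\setminus\{0\}$ with transition probabilities $p_{x,y}=\frac{a(y)}{4a(x)}\mathbf 1_{|x-y|=1}$. Let $A\subset\mathbb Z^2$ be a finite set containing $0$. Let $\tau_A$ and $\widehat\tau_A$ be the hitting times $\min\{n\ge 0:\cdot\in A\}$ of $A$ by $S$ and by $\widehat S$ respectively ($\infty$ if $A$ is never hit), and put $q_A(x)=a(x)-\mathbb E_x[a(S_{\tau_A})]$. Let $U_A$ be the infinite connected component of $\mathbb Z^2\setminus A$ (with respect to nearest-neighbour paths), and let $\widehat S^{(A)}$ be the Markov chain on $U_A$ with transition probabilities $p^{(A)}_{x,y}=\frac{q_A(y)}{4q_A(x)}\mathbf 1_{|x-y|=1}$. 1. These objects are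 well defined: the limit defining $a(x)$ exists for every $x$; $a(x)>0$ and $\sum_y p_{x,y}=1$ with $p_{x,y}\ge 0$ for every $x\neq 0$; $\tau_A<\infty$ $\mathbb P_x$-a.s. for every $x$; and $q_A(x)>0$ and $\sum_y p^{(A)}_{x,y}=1$ with $p^{(A)}_{x,y}\ge 0$ for every $x\in U_A$. 2. For every $x_0\notin A$, $$\mathbb P_{x_0}[\widehat\tau_A=\infty]=\frac{q_A(x_0)}{a(x_0)}.$$ 3. For every $x_0\in U_A$ one has $\mathbb P_{x_0}[\widehat\tau_A=\infty]>0$, and for every nearest-neighbour path $\gamma=(\gamma_0,\gamma_1,\dots,\gamma_m)$ with $\gamma_0=x_0$ which does not touch $A$, $$\mathbb P_{x_0}\big[\widehat S_1=\gamma_1,\dots,\widehat S_m=\gamma_m\,\big|\,\widehat\tau_A=\infty\big]=\mathbb P_{x_0}\big[\widehat S^{(A)}_1=\gamma_1,\dots,\widehat S^{(A)}_m=\gamma_m\big].$$ That is, the law of $\widehat S$ started at $x_0$ and conditioned on never hitting $A$ equals the law of $\widehat S^{(A)}$ started at $x_0$, as probability measures on the space of trajectories. -/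

import Mathlib

open MeasureTheory ProbabilityTheory Filter Topology

noncomputable section

namespace CondWalk

/-- The lattice `ℤ²`. -/
abbrev Site : Type := ℤ × ℤ

/-- The trajectories `(S₀, S₁, S₂, …)` in `ℤ²`, with the product σ-algebra. -/
abbrev Path : Type := ℕ → Site

/-- `|x - y| = 1` in the Euclidean norm (written with squares; the norm that Mathlib puts on
`ℤ × ℤ` is the sup norm). -/
def Nbr (x y : Site) : Prop := (x.1 - y.1) ^ 2 + (x.2 - y.2) ^ 2 = 1

/-! ### Markov chains on the lattice -/

/-- The row at `x` of the transition matrix `p` is a probability distribution. -/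
def IsStochasticRow (p : Site → Site → ℝ) (x : Site) : Prop :=
  (∀ y, 0 ≤ p x y) ∧ HasSum (p x) 1

open Classical in
/-- The distribution of one step from `x`: it is `p x ·` when that is a probability distribution.
At the other states (outside the state space of the chain) the chain does not move. -/
def stepPMF (p : Site → Site → ℝ) (x : Site) : PMF Site :=
  if h : IsStochasticRow p x then
    ⟨fun y => ENNReal.ofReal (p x y), by
      have h1 : ∑' y, ENNReal.ofReal (p x y) = 1 := by
        rw [← ENNReal.ofReal_tsum_of_nonneg h.1 h.2.summable, h.2.tsum_eq, ENNReal.ofReal_one]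
      exact h1 ▸ ENNReal.summable.hasSum⟩
  else PMF.pure x

/-- The one-step transition kernel of the chain with transition matrix `p`. -/
def stepKernel (p : Site → Site → ℝ) : Kernel Site Site where
  toFun x := (stepPMF p x).toMeasure
  measurable' := measurable_of_countable _

instance (p : Site → Site → ℝ) : IsMarkovKernel (stepKernel p) :=
  ⟨fun x => inferInstanceAs (IsProbabilityMeasure (stepPMF p x).toMeasure)⟩

/-- `ℙ_x`: the law on the space of trajectories of the (time-homogeneous) Markov chain with
transition matrix `p` started at `x`: the next state depends on the history only through the
present state. -/
def chainLaw (p : Site → Site → ℝ) (x : Site) : Measure Path :=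
  Kernel.trajMeasure (X := fun _ => Site) (Measure.dirac x)
    (fun n => (stepKernel p).comap
      (fun h : (i : Finset.Iic n) → Site => h ⟨n, Finset.mem_Iic.2 le_rfl⟩)
      (measurable_pi_apply _))

/-- Hitting time `min {n ≥ 0 : S_n ∈ A}` of `A`; it is `⊤` for a trajectory that avoids `A`. -/
def hitTime (A : Finset Site) : Path → WithTop ℕ :=
  hittingAfter (fun (n : ℕ) (S : Path) => S n) (A : Set Site) 0

/-! ### Simple random walk, its potential kernel, and its Doob transforms -/

open Classical in
/-- Transition probabilities of simple random walk on `ℤ²`. -/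
def srwStep (x y : Site) : ℝ := if Nbr x y then 1 / 4 else 0

/-- The law of simple random walk `S` started at `x`. -/
def srwLaw (x : Site) : Measure Path := chainLaw srwStep x

/-- The partial sums `∑_{n < N} (ℙ₀[S_n = 0] - ℙ₀[S_n = x])`. -/
def potentialPartialSum (x : Site) (N : ℕ) : ℝ :=
  ∑ n ∈ Finset.range N,
    ((srwLaw 0).real {S : Path | S n = 0} - (srwLaw 0).real {S : Path | S n = x})

/-- The potential kernel `a(x) = ∑_{n ≥ 0} (ℙ₀[S_n = 0] - ℙ₀[S_n = x])`. The series does not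
converge absolutely for all `x` (parity), so it is the limit of its partial sums. -/
def potentialKernel (x : Site) : ℝ := limUnder atTop (potentialPartialSum x)

/-- `q_A(x) = a(x) - 𝔼_x[a(S_{τ_A})]`. -/
def qFun (A : Finset Site) (x : Site) : ℝ :=
  potentialKernel x -
    ∫ S, potentialKernel (stoppedValue (fun (n : ℕ) (S : Path) => S n) (hitTime A) S) ∂(srwLaw x)

open Classical in
/-- Transition probabilities `h(y) / (4 h(x)) 1_{|x - y| = 1}` of the Doob transform of simple
random walk with respect to `h`. -/
def doobStep (h : Site → ℝ) (x y : Site) : ℝ := if Nbr x y then h y / (4 * h x) else 0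

/-- The law of `Ŝ`, the walk conditioned on not hitting the origin, started at `x`. -/
def condLaw (x : Site) : Measure Path := chainLaw (doobStep potentialKernel) x

/-- The law of `Ŝ^{(A)}`, the Doob transform of simple random walk with respect to `q_A`,
started at `x`. -/
def condLawOf (A : Finset Site) (x : Site) : Measure Path := chainLaw (doobStep (qFun A)) x

/-- `x` lies in the infinite connected component of `ℤ² \ A`: it is outside `A`, and infinitely many
sites can be reached from it by nearest-neighbour paths that avoid `A`. -/
def InInfiniteComponent (A : Finset Site) (x : Site) : Prop :=
  x ∉ A ∧ {y : Site | Relation.ReflTransGen (fun u v => Nbr u v ∧ v ∉ A) x y}.Infinite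

end CondWalk

end

/-! Everything rests on one identity, `qFun_eq`: q_A(x) = a(x) · P̂_x[τ̂_A = ∞]. Multiplying by a(x)
cancels the denominator of the Doob transform. So a(x) P̂_x[τ̂_A ≤ n] and the sum over y in A of
a(y) P_x[τ_A ≤ n, S_τ = y] obey the same first-step recursion off A and agree on A
(`mul_condLaw_hitBy`). Letting n tend to infinity gives the identity, with no strong Markov property
or optional stopping. It shows at once that q_A is nonnegative, vanishes on A and is harmonic off A.
The same cancellation, applied to avoidance intersected with a cylinder, identifies the conditioned
law (`mul_condLaw_avoid_inter_cyl`), because laws on trajectories are determined by cylinders.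

The analytic input is elementary. At sites of even parity, AM-GM makes the partial sums of a
monotone, and averaging them over k steps bounds them (`pot_bddAbove`). Odd sites follow from
harmonicity and the decay of return probabilities (`tendsto_heat`). A second-moment bound makes
Green's function diverge, so a tends to infinity (`finite_potentialKernel_le`). This growth gives
recurrence, through a minimum principle (`srwLaw_avoid`), and positivity of q_A on the infinite
component (`qFun_pos`). -/

noncomputable section

namespace CondWalk

/-! ### Cylinders and the first-step decomposition -/

/-- The trajectories that agree with `γ` up to time `m`. -/
def cyl (m : ℕ) (γ : Path) : Set Path := {S | ∀ i ≤ m, S i = γ i}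

lemma cyl_eq_preimage (m : ℕ) (γ : Path) :
    cyl m γ = Preorder.frestrictLe (π := fun _ => Site) m ⁻¹'
      {Preorder.frestrictLe (π := fun _ => Site) m γ} := by
  ext S
  simp only [cyl, Set.mem_ofPred_eq, Set.mem_preimage, Set.mem_singleton_iff, funext_iff,
    Subtype.forall, Finset.mem_Iic, Preorder.frestrictLe_apply]

lemma measurableSet_cyl (m : ℕ) (γ : Path) : MeasurableSet (cyl m γ) := by
  rw [cyl_eq_preimage]
  exact Preorder.measurable_frestrictLe m (measurableSet_singleton _)

/-- Finite-dimensional marginals determine a law on trajectories, and on the countable space of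
initial segments singletons determine a measure. -/
lemma ext_of_cyl {μ ν : Measure Path} [IsFiniteMeasure μ]
    (h : ∀ m γ, μ (cyl m γ) = ν (cyl m γ)) : μ = ν := by
  have hP : IsProjectiveMeasureFamily (α := fun _ : ℕ => Site) fun I => μ.map I.restrict := by
    intro I J hJI
    rw [Measure.map_map (by fun_prop) (by fun_prop), Finset.restrict₂_comp_restrict]
  refine IsProjectiveLimit.unique (α := fun _ : ℕ => Site) (P := fun I => μ.map I.restrict)
    (fun I => rfl) ((isProjectiveLimit_nat_iff hP ν).2 fun n => ?_)
  refine Measure.ext_of_singleton fun s => ?_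
  obtain ⟨γ, rfl⟩ : ∃ γ : Path, Preorder.frestrictLe (π := fun _ => Site) n γ = s :=
    ⟨fun i => if hi : i ≤ n then s ⟨i, Finset.mem_Iic.2 hi⟩ else 0, by
      ext i : 1
      exact dif_pos (Finset.mem_Iic.1 i.2)⟩
  rw [Measure.map_apply (Preorder.measurable_frestrictLe n) (measurableSet_singleton _),
    ← cyl_eq_preimage, ← h, cyl_eq_preimage]
  exact (Measure.map_apply (Preorder.measurable_frestrictLe n) (measurableSet_singleton _)).symm

instance (p : Site → Site → ℝ) (x : Site) : IsProbabilityMeasure (chainLaw p x) := by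
  unfold chainLaw; infer_instance

lemma stepKernel_singleton (p : Site → Site → ℝ) (x y : Site) :
    stepKernel p x {y} = stepPMF p x y :=
  PMF.toMeasure_apply_singleton _ _ (measurableSet_singleton _)

lemma chainLaw_map_zero (p : Site → Site → ℝ) (x : Site) :
    (chainLaw p x).map (fun S => S 0) = Measure.dirac x := by
  unfold chainLaw Kernel.trajMeasure
  have h : (fun S : Path => S 0) =
      (MeasurableEquiv.piUnique (fun i : Finset.Iic 0 => Site)) ∘
        (Preorder.frestrictLe (π := fun _ => Site) 0) := by
    ext1 S; rfl
  rw [h, ← Measure.map_map (by fun_prop) (by fun_prop), Measure.map_comp _ _ (by fun_prop),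
    Kernel.traj_map_frestrictLe, Kernel.partialTraj_self, Measure.id_comp]
  exact MeasurableEquiv.map_map_symm _

lemma chainLaw_cyl_zero (p : Site → Site → ℝ) (x : Site) (γ : Path) :
    chainLaw p x (cyl 0 γ) = if γ 0 = x then 1 else 0 := by
  have h : cyl 0 γ = (fun S : Path => S 0) ⁻¹' {γ 0} := by
    ext S; simp [cyl]
  rw [h, ← Measure.map_apply (by fun_prop) (measurableSet_singleton _), chainLaw_map_zero]
  simp [Set.indicator_apply, eq_comm]

lemma chainLaw_cyl_succ (p : Site → Site → ℝ) (x : Site) (m : ℕ) (γ : Path) :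
    chainLaw p x (cyl (m + 1) γ) =
      chainLaw p x (cyl m γ) * stepPMF p (γ m) (γ (m + 1)) := by
  have key := Kernel.map_frestrictLe_trajMeasure_compProd_eq_map_trajMeasure
    (X := fun _ => Site) (μ₀ := Measure.dirac x)
    (κ := fun n => (stepKernel p).comap
      (fun h : (i : Finset.Iic n) → Site => h ⟨n, Finset.mem_Iic.2 le_rfl⟩)
      (measurable_pi_apply _)) (a := m)
  have h := congrArg (fun μ => μ ({Preorder.frestrictLe (π := fun _ => Site) m γ} ×ˢ
    {γ (m + 1)})) key
  rw [Measure.compProd_apply_prod (measurableSet_singleton _) (measurableSet_singleton _),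
    Measure.map_apply (by fun_prop) ((measurableSet_singleton _).prod (measurableSet_singleton _)),
    lintegral_singleton, Measure.map_apply (by fun_prop) (measurableSet_singleton _),
    ← cyl_eq_preimage] at h
  rw [mul_comm, ← stepKernel_singleton]
  have hset : cyl (m + 1) γ = (fun S : Path => (Preorder.frestrictLe (π := fun _ => Site) m S,
      S (m + 1))) ⁻¹' ({Preorder.frestrictLe (π := fun _ => Site) m γ} ×ˢ {γ (m + 1)}) := by
    ext S
    simp only [Set.mem_preimage, Set.mem_prod, Set.mem_singleton_iff]
    simp only [cyl, Set.mem_ofPred_eq, funext_iff, Subtype.forall, Finset.mem_Iic,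
      Preorder.frestrictLe_apply]
    constructor
    · intro h
      exact ⟨fun i hi => h i (by omega), h _ le_rfl⟩
    · rintro ⟨h1, h2⟩ i hi
      rcases Nat.lt_or_ge m i with h | h
      · obtain rfl : i = m + 1 := by omega
        exact h2
      · exact h1 i h
  rw [hset]
  exact h.symm

lemma chainLaw_cyl (p : Site → Site → ℝ) (x : Site) (m : ℕ) (γ : Path) :
    chainLaw p x (cyl m γ) =
      (if γ 0 = x then 1 else 0) * ∏ i ∈ Finset.range m, stepPMF p (γ i) (γ (i + 1)) := by
  induction m with
  | zero => simp [chainLaw_cyl_zero]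
  | succ m ih => rw [chainLaw_cyl_succ, ih, Finset.prod_range_succ, mul_assoc]

/-- The trajectory that starts at `x` and then follows `S`. -/
def pathCons (x : Site) (S : Path) : Path
  | 0 => x
  | n + 1 => S n

@[simp] lemma pathCons_zero (x : Site) (S : Path) : pathCons x S 0 = x := rfl

@[simp] lemma pathCons_succ (x : Site) (S : Path) (n : ℕ) : pathCons x S (n + 1) = S n := rfl

lemma measurable_pathCons (x : Site) : Measurable (pathCons x) := by
  refine measurable_pi_lambda _ fun n => ?_
  cases n with
  | zero => exact measurable_const
  | succ n => exact measurable_pi_apply n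

lemma pathCons_preimage_cyl_zero (x : Site) (γ : Path) :
    pathCons x ⁻¹' cyl 0 γ = if γ 0 = x then Set.univ else ∅ := by
  ext S
  split_ifs with h <;> simp [cyl, h, eq_comm]

lemma pathCons_preimage_cyl_succ (x : Site) (m : ℕ) (γ : Path) :
    pathCons x ⁻¹' cyl (m + 1) γ =
      if γ 0 = x then cyl m (fun i => γ (i + 1)) else ∅ := by
  ext S
  split_ifs with h
  · simp only [cyl, Set.mem_preimage, Set.mem_ofPred_eq]
    constructor
    · intro H i hi
      exact H (i + 1) (by omega)
    · rintro H (_ | i) hi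
      · exact h.symm
      · exact H i (by omega)
  · simp only [cyl, Set.mem_preimage, Set.mem_ofPred_eq, Set.mem_empty_iff_false, iff_false]
    intro H
    exact h (H 0 (by omega)).symm

/-- The Markov property at time 1, checked on cylinders, where only the term `y = γ 1` survives. All
later inductions on time go through it. -/
lemma chainLaw_eq_sum (p : Site → Site → ℝ) (x : Site) :
    chainLaw p x =
      Measure.sum fun y => stepPMF p x y • (chainLaw p y).map (pathCons x) := by
  refine ext_of_cyl fun m γ => ?_
  rw [Measure.sum_apply _ (measurableSet_cyl m γ)]
  simp only [Measure.smul_apply, smul_eq_mul,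
    Measure.map_apply (measurable_pathCons x) (measurableSet_cyl m γ)]
  cases m with
  | zero =>
    rw [chainLaw_cyl_zero, pathCons_preimage_cyl_zero]
    split_ifs
    · simp [(stepPMF p x).tsum_coe]
    · simp
  | succ m =>
    rw [chainLaw_cyl, pathCons_preimage_cyl_succ]
    split_ifs with h
    · rw [tsum_eq_single (γ 1)]
      · rw [chainLaw_cyl, Finset.prod_range_succ']
        simp [h, mul_comm]
      · intro y hy
        rw [chainLaw_cyl]
        simp [hy.symm]
    · simp

/-- First-step decomposition. -/
lemma chainLaw_apply (p : Site → Site → ℝ) (x : Site) {E : Set Path} (hE : MeasurableSet E) :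
    chainLaw p x E = ∑' y, stepPMF p x y * chainLaw p y (pathCons x ⁻¹' E) := by
  conv_lhs => rw [chainLaw_eq_sum]
  rw [Measure.sum_apply _ hE]
  simp only [Measure.smul_apply, smul_eq_mul, Measure.map_apply (measurable_pathCons x) hE]

lemma ae_start (p : Site → Site → ℝ) (x : Site) : ∀ᵐ S ∂(chainLaw p x), S 0 = x := by
  have h : ∀ᵐ y ∂((chainLaw p x).map (fun S : Path => S 0)), y = x := by
    rw [chainLaw_map_zero]
    simp [ae_dirac_eq]
  exact ae_of_ae_map (measurable_pi_apply 0).aemeasurable h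

/-! ### Nearest-neighbour chains -/

/-- The average of `f` over the four neighbours. -/
def avg (f : Site → ℝ) (x : Site) : ℝ :=
  (f (x + (1, 0)) + f (x + (-1, 0)) + f (x + (0, 1)) + f (x + (0, -1))) / 4

/-- The four neighbours of `x`. -/
def nbrs (x : Site) : Finset Site := {x + (1, 0), x + (-1, 0), x + (0, 1), x + (0, -1)}

lemma sum_nbrs {M : Type*} [AddCommMonoid M] (f : Site → M) (x : Site) :
    ∑ y ∈ nbrs x, f y =
      f (x + (1, 0)) + (f (x + (-1, 0)) + (f (x + (0, 1)) + f (x + (0, -1)))) := by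
  unfold nbrs
  rw [Finset.sum_insert, Finset.sum_insert, Finset.sum_insert, Finset.sum_singleton] <;>
    simp [Prod.ext_iff]

lemma avg_eq_sum (f : Site → ℝ) (x : Site) : avg f x = (∑ y ∈ nbrs x, f y) / 4 := by
  rw [sum_nbrs, avg]; ring

lemma mem_nbrs {x y : Site} : y ∈ nbrs x ↔ Nbr x y := by
  obtain ⟨a, b⟩ := x
  obtain ⟨c, d⟩ := y
  simp only [nbrs, Nbr, Finset.mem_insert, Finset.mem_singleton, Prod.mk_add_mk, Prod.mk.injEq]
  constructor
  · rintro (⟨rfl, rfl⟩ | ⟨rfl, rfl⟩ | ⟨rfl, rfl⟩ | ⟨rfl, rfl⟩) <;> ring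
  · intro h
    have h1 : (a - c) ^ 2 ≤ 1 := by nlinarith [sq_nonneg (b - d)]
    have h2 : (b - d) ^ 2 ≤ 1 := by nlinarith [sq_nonneg (a - c)]
    obtain ⟨h3, h4⟩ := abs_le.1 ((sq_le_one_iff_abs_le_one _).1 h1)
    obtain ⟨h5, h6⟩ := abs_le.1 ((sq_le_one_iff_abs_le_one _).1 h2)
    obtain ⟨u, hu⟩ : ∃ u, a - c = u := ⟨_, rfl⟩
    obtain ⟨v, hv⟩ : ∃ v, b - d = v := ⟨_, rfl⟩
    rw [hu] at h h3 h4
    rw [hv] at h h5 h6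
    interval_cases u <;> interval_cases v <;> norm_num at h <;> omega

lemma Nbr.symm {x y : Site} (h : Nbr x y) : Nbr y x := by
  unfold Nbr at *; linarith

/-- Dividing by `h x` only once is the source of all later cancellations: `h` times an expectation
for the transformed chain evolves under plain averaging. -/
lemma hasSum_doobStep_mul (h g : Site → ℝ) (x : Site) :
    HasSum (fun y => doobStep h x y * g y) (avg (fun y => h y * g y) x / h x) := by
  have : avg (fun y => h y * g y) x / h x = ∑ y ∈ nbrs x, doobStep h x y * g y := by
    rw [avg_eq_sum, Finset.sum_div, Finset.sum_div]
    refine Finset.sum_congr rfl fun y hy => ?_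
    rw [doobStep, if_pos (mem_nbrs.1 hy)]
    ring
  rw [this]
  refine hasSum_sum_of_ne_finset_zero fun y hy => ?_
  rw [doobStep, if_neg (fun h => hy (mem_nbrs.2 h)), zero_mul]

lemma isStochasticRow_doobStep {h : Site → ℝ} {x : Site} (hx : 0 < h x)
    (hn : ∀ y, Nbr x y → 0 ≤ h y) (hh : avg h x = h x) : IsStochasticRow (doobStep h) x := by
  refine ⟨fun y => ?_, ?_⟩
  · unfold doobStep
    split_ifs with H
    · have := hn y H
      positivity
    · exact le_rfl
  · have := hasSum_doobStep_mul h (fun _ => 1) x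
    simpa [hh, hx.ne'] using this

lemma stepPMF_toReal {p : Site → Site → ℝ} {x : Site} (h : IsStochasticRow p x) (y : Site) :
    (stepPMF p x y).toReal = p x y := by
  have e : stepPMF p x = (⟨fun y => ENNReal.ofReal (p x y), _⟩ : PMF Site) := dif_pos h
  rw [e]
  exact ENNReal.toReal_ofReal (h.1 y)

/-- First-step decomposition for a Doob transform of simple random walk. -/
lemma chainLaw_doobStep_real {h : Site → ℝ} {x : Site} (hx : IsStochasticRow (doobStep h) x)
    {E : Set Path} (hE : MeasurableSet E) :
    (chainLaw (doobStep h) x).real E =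
      avg (fun y => h y * (chainLaw (doobStep h) y).real (pathCons x ⁻¹' E)) x / h x := by
  rw [Measure.real, chainLaw_apply _ _ hE, ENNReal.tsum_toReal_eq]
  · rw [← (hasSum_doobStep_mul h _ x).tsum_eq]
    refine tsum_congr fun y => ?_
    rw [ENNReal.toReal_mul, stepPMF_toReal hx]
    rfl
  · intro y
    exact ENNReal.mul_ne_top (PMF.apply_ne_top _ _) (measure_ne_top _ _)

lemma srwStep_eq : srwStep = doobStep fun _ => 1 := by
  ext x y
  simp [srwStep, doobStep]

lemma avg_const (c : ℝ) (x : Site) : avg (fun _ => c) x = c := by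
  unfold avg; ring

lemma isStochasticRow_srwStep (x : Site) : IsStochasticRow srwStep x := by
  rw [srwStep_eq]
  exact isStochasticRow_doobStep one_pos (fun _ _ => zero_le_one) (avg_const 1 x)

instance (x : Site) : IsProbabilityMeasure (srwLaw x) := by
  unfold srwLaw; infer_instance

instance (x : Site) : IsProbabilityMeasure (condLaw x) := by
  unfold condLaw; infer_instance

lemma srwLaw_real (x : Site) {E : Set Path} (hE : MeasurableSet E) :
    (srwLaw x).real E = avg (fun y => (srwLaw y).real (pathCons x ⁻¹' E)) x := by
  unfold srwLaw
  rw [srwStep_eq, chainLaw_doobStep_real (srwStep_eq ▸ isStochasticRow_srwStep x) hE]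
  simp

/-! ### The heat kernel of simple random walk -/

lemma avg_add (f g : Site → ℝ) (x : Site) : avg (fun y => f y + g y) x = avg f x + avg g x := by
  unfold avg; ring

lemma avg_sub (f g : Site → ℝ) (x : Site) : avg (fun y => f y - g y) x = avg f x - avg g x := by
  unfold avg; ring

lemma avg_const_mul (c : ℝ) (f : Site → ℝ) (x : Site) :
    avg (fun y => c * f y) x = c * avg f x := by
  unfold avg; ring

lemma avg_sum {ι : Type*} (s : Finset ι) (f : ι → Site → ℝ) (x : Site) :
    avg (fun y => ∑ i ∈ s, f i y) x = ∑ i ∈ s, avg (f i) x := by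
  unfold avg
  rw [← Finset.sum_div]
  simp only [Finset.sum_add_distrib]

lemma avg_congr {f g : Site → ℝ} {x : Site} (h : ∀ y, Nbr x y → f y = g y) :
    avg f x = avg g x := by
  rw [avg_eq_sum, avg_eq_sum, Finset.sum_congr rfl fun y hy => h y (mem_nbrs.1 hy)]

lemma avg_mono {f g : Site → ℝ} {x : Site} (h : ∀ y, Nbr x y → f y ≤ g y) :
    avg f x ≤ avg g x := by
  rw [avg_eq_sum, avg_eq_sum]
  exact div_le_div_of_nonneg_right (Finset.sum_le_sum fun y hy => h y (mem_nbrs.1 hy)) (by norm_num)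

lemma avg_comp_sub (f : Site → ℝ) (x z : Site) : avg (fun y => f (y - z)) x = avg f (x - z) := by
  unfold avg
  simp only [add_sub_right_comm]

lemma tendsto_avg {ι : Type*} {l : Filter ι} {f : ι → Site → ℝ} {g : Site → ℝ} {x : Site}
    (h : ∀ y, Nbr x y → Tendsto (fun i => f i y) l (𝓝 (g y))) :
    Tendsto (fun i => avg (f i) x) l (𝓝 (avg g x)) := by
  simp only [avg_eq_sum]
  exact (tendsto_finsetSum _ fun y hy => h y (mem_nbrs.1 hy)).div_const 4

lemma site_induction {P : Site → Prop} (h0 : P 0) (h : ∀ x y, Nbr x y → P x → P y) (x : Site) :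
    P x := by
  have h1 : ∀ a : ℤ, P (a, 0) := by
    intro a
    induction a using Int.induction_on with
    | zero => exact h0
    | succ a ih => exact h _ _ (by simp [Nbr]) ih
    | pred a ih => exact h _ _ (by simp [Nbr]) ih
  obtain ⟨a, b⟩ := x
  induction b using Int.induction_on with
  | zero => exact h1 a
  | succ b ih => exact h _ _ (by simp [Nbr]) ih
  | pred b ih => exact h _ _ (by simp [Nbr]) ih

/-- `heat n x` is the probability that simple random walk goes from `0` to `x` in `n` steps. -/
def heat : ℕ → Site → ℝ
  | 0 => fun x => if x = 0 then 1 else 0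
  | n + 1 => avg (heat n)

lemma heat_zero (x : Site) : heat 0 x = if x = 0 then 1 else 0 := rfl

lemma heat_succ (n : ℕ) (x : Site) : heat (n + 1) x = avg (heat n) x := rfl

lemma heat_add (m n : ℕ) : heat (m + n) = avg^[n] (heat m) := by
  induction n with
  | zero => rfl
  | succ n ih =>
    rw [Function.iterate_succ_apply', ← ih]
    rfl

lemma heat_nonneg (n : ℕ) (x : Site) : 0 ≤ heat n x := by
  induction n generalizing x with
  | zero => rw [heat_zero]; split_ifs <;> norm_num
  | succ n ih =>
    rw [heat_succ, ← avg_const 0 x]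
    exact avg_mono fun y _ => ih y

lemma heat_neg (n : ℕ) (x : Site) : heat n (-x) = heat n x := by
  induction n generalizing x with
  | zero => simp [heat_zero]
  | succ n ih =>
    simp only [heat_succ, avg]
    rw [← ih (x + (1, 0)), ← ih (x + (-1, 0)), ← ih (x + (0, 1)), ← ih (x + (0, -1))]
    simp only [neg_add, Prod.neg_mk, neg_neg, neg_zero]
    ring

lemma heat_eq_zero_of_parity {n : ℕ} {x : Site} (h : Odd (n + x.1 + x.2)) : heat n x = 0 := by
  induction n generalizing x with
  | zero =>
    rw [heat_zero, if_neg]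
    rintro rfl
    simp at h
  | succ n ih =>
    rw [heat_succ, avg, ih, ih, ih, ih]
    · simp
    all_goals
      rw [Int.odd_iff] at h ⊢
      simp only [Prod.fst_add, Prod.snd_add]
      push_cast at h
      omega

lemma heat_eq_zero_of_lt {n : ℕ} {x : Site} (h : (n : ℤ) < |x.1| + |x.2|) : heat n x = 0 := by
  induction n generalizing x with
  | zero =>
    rw [heat_zero, if_neg]
    rintro rfl
    simp at h
  | succ n ih =>
    rw [heat_succ, avg, ih, ih, ih, ih]
    · simp
    all_goals
      simp only [Prod.fst_add, Prod.snd_add, abs_eq_max_neg] at h ⊢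
      push_cast at h
      omega

lemma exists_heat_pos (x : Site) : ∃ n, 0 < heat n x := by
  refine site_induction (P := fun x => ∃ n, 0 < heat n x) ⟨0, by simp [heat_zero]⟩ ?_ x
  rintro x y hxy ⟨n, hn⟩
  refine ⟨n + 1, ?_⟩
  rw [heat_succ, avg_eq_sum]
  have := Finset.single_le_sum (f := heat n) (fun z _ => heat_nonneg n z) (mem_nbrs.2 hxy.symm)
  linarith

/-- Iterated averaging is convolution with the n-step distribution; each of the four shifts is a
reindexing of the sum. -/
lemma hasSum_heat_mul (n : ℕ) (f : Site → ℝ) (x : Site) :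
    HasSum (fun z => heat n z * f (x + z)) (avg^[n] f x) := by
  induction n generalizing x with
  | zero =>
    have := hasSum_ite_eq (0 : Site) (f x)
    refine this.congr_fun fun z => ?_
    rw [heat_zero]
    split_ifs with h <;> simp [h]
  | succ n ih =>
    have shift : ∀ e : Site,
        HasSum (fun z => heat n (z + e) * f (x + z)) (avg^[n] f (x + -e)) := by
      intro e
      have := (Equiv.addRight e).hasSum_iff.2 (ih (x + -e))
      refine this.congr_fun fun z => ?_
      simp only [Function.comp, Equiv.coe_addRight]
      congr 2
      abel
    have h := ((((shift (1, 0)).add (shift (-1, 0))).add (shift (0, 1))).add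
      (shift (0, -1))).div_const 4
    rw [Function.iterate_succ_apply']
    have e : avg (avg^[n] f) x = (avg^[n] f (x + -(1, 0)) + avg^[n] f (x + -(-1, 0)) +
        avg^[n] f (x + -(0, 1)) + avg^[n] f (x + -(0, -1))) / 4 := by
      rw [avg]
      simp only [Prod.neg_mk, neg_neg, neg_zero]
      ring
    rw [e]
    refine h.congr_fun fun z => ?_
    rw [heat_succ, avg]
    ring

lemma hasSum_heat (n : ℕ) : HasSum (heat n) 1 := by
  have h := hasSum_heat_mul n (fun _ => 1) 0
  have : avg^[n] (fun _ : Site => (1 : ℝ)) = fun _ => 1 :=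
    Function.iterate_fixed (funext fun x => avg_const 1 x) n
  simpa [this] using h

lemma hasSum_heat_mul_heat (m n : ℕ) (x : Site) :
    HasSum (fun z => heat n z * heat m (x + z)) (heat (m + n) x) := by
  rw [heat_add]
  exact hasSum_heat_mul n (heat m) x

/-- By Chapman–Kolmogorov the left side is a correlation of `heat m` with its translate. AM-GM
bounds it by the mean of the two sums of squares, both equal to `heat (2 * m) 0`. -/
lemma heat_two_mul_le (m : ℕ) (x : Site) : heat (2 * m) x ≤ heat (2 * m) 0 := by
  rw [two_mul]
  have h1 := hasSum_heat_mul_heat m m x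
  have h2 := hasSum_heat_mul_heat m m 0
  have h3 : HasSum (fun z => heat m (x + z) * heat m (x + z)) (heat (m + m) 0) := by
    refine ((Equiv.addLeft x).hasSum_iff.2 h2).congr_fun fun z => ?_
    simp
  have h4 := (h2.add h3).div_const 2
  rw [add_self_div_two] at h4
  refine hasSum_le (fun z => ?_) h1 h4
  rw [zero_add]
  nlinarith [sq_nonneg (heat m z - heat m (x + z))]

lemma heat_odd_eq_zero {n : ℕ} (hn : ¬ Even n) {x : Site} (hx : Even (x.1 + x.2)) :
    heat n x = 0 := by
  apply heat_eq_zero_of_parity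
  rw [Int.odd_iff]
  rw [Int.even_iff] at hx
  rw [Nat.even_iff] at hn
  omega

lemma heat_le_of_even (n : ℕ) {x : Site} (hx : Even (x.1 + x.2)) : heat n x ≤ heat n 0 := by
  by_cases hn : Even n
  · obtain ⟨m, rfl⟩ := hn
    rw [← two_mul]
    exact heat_two_mul_le m x
  · rw [heat_odd_eq_zero hn hx]
    exact heat_nonneg n 0

/-! ### Green's function and the partial sums of the potential kernel -/

/-- The expected number of visits to `x` before time `N`. -/
def green (N : ℕ) (x : Site) : ℝ := ∑ n ∈ Finset.range N, heat n x

lemma green_succ (N : ℕ) (x : Site) : green (N + 1) x = green N x + heat N x :=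
  Finset.sum_range_succ _ _

lemma green_succ' (N : ℕ) (x : Site) :
    green (N + 1) x = avg (green N) x + if x = 0 then 1 else 0 := by
  unfold green
  rw [Finset.sum_range_succ', avg_sum]
  rfl

lemma green_mono (x : Site) : Monotone fun N => green N x :=
  monotone_nat_of_le_succ fun N => by
    rw [green_succ]
    exact le_add_of_nonneg_right (heat_nonneg N x)

/-- Averaging k times shifts time by k, turning the window [0, N) into [k, N + k). -/
lemma avg_iterate_green (N k : ℕ) (x : Site) :
    avg^[k] (green N) x = green (N + k) x - green k x := by
  induction k generalizing x with
  | zero => simp [green]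
  | succ k ih =>
    rw [Function.iterate_succ_apply', avg_congr fun y _ => ih y, avg_sub,
      ← add_assoc, green_succ' (N + k), green_succ' k]
    ring

/-- `green N 0 - green N x`, the partial sums of the potential kernel. -/
def pot (N : ℕ) (x : Site) : ℝ := green N 0 - green N x

lemma pot_eq_sum (N : ℕ) (x : Site) :
    pot N x = ∑ n ∈ Finset.range N, (heat n 0 - heat n x) := by
  rw [Finset.sum_sub_distrib]; rfl

lemma pot_succ (N : ℕ) (x : Site) : pot (N + 1) x = pot N x + (heat N 0 - heat N x) := by
  simp only [pot_eq_sum, Finset.sum_range_succ]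

lemma pot_succ' (N : ℕ) {x : Site} (hx : x ≠ 0) :
    pot (N + 1) x = heat N 0 + avg (pot N) x := by
  have : avg (pot N) x = green N 0 - avg (green N) x := by
    unfold pot
    rw [avg_sub, avg_const]
  rw [this, pot, green_succ, green_succ' N x, if_neg hx]
  ring

lemma pot_mono {x : Site} (hx : Even (x.1 + x.2)) : Monotone fun N => pot N x :=
  monotone_nat_of_le_succ fun N => by
    rw [pot_succ]
    linarith [heat_le_of_even N hx]

lemma pot_nonneg (N : ℕ) {x : Site} (hx : Even (x.1 + x.2)) : 0 ≤ pot N x := by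
  have := pot_mono hx (Nat.zero_le N)
  simpa [pot, green] using this

/-- The mean of `pot N` under `heat k` is `green N 0 - green (N + k) 0 + green k 0`, at most `green
k 0` for every `N`. When `heat k x > 0`, `k` is even, so only even sites are charged, all terms are
nonnegative, and the term at `x` alone obeys the bound. -/
lemma pot_bddAbove {x : Site} (hx : Even (x.1 + x.2)) : BddAbove (Set.range fun N => pot N x) := by
  obtain ⟨k, hk⟩ := exists_heat_pos x
  have hk2 : Even k := by
    by_contra h
    exact hk.ne' (heat_odd_eq_zero h hx)
  refine ⟨green k 0 / heat k x, ?_⟩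
  rintro _ ⟨N, rfl⟩
  rw [le_div_iff₀ hk]
  have h1 : HasSum (fun z => heat k z * pot N z)
      (green N 0 - (green (N + k) 0 - green k 0)) := by
    have h2 := hasSum_heat_mul k (green N) 0
    rw [avg_iterate_green] at h2
    have h3 := ((hasSum_heat k).mul_right (green N 0)).sub h2
    rw [one_mul] at h3
    refine h3.congr_fun fun z => ?_
    rw [pot, zero_add]
    ring
  have h3 : heat k x * pot N x ≤ green N 0 - (green (N + k) 0 - green k 0) := by
    refine le_hasSum h1 x fun z _ => ?_
    by_cases hz : Even (z.1 + z.2)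
    · exact mul_nonneg (heat_nonneg _ _) (pot_nonneg N hz)
    · rw [heat_eq_zero_of_parity, zero_mul]
      rw [Int.not_even_iff_odd] at hz
      rw [add_assoc]
      exact (Int.even_coe_nat k |>.2 hk2).add_odd hz
  have h4 := green_mono 0 (Nat.le_add_right N k)
  simp only at h4
  linarith

lemma exists_tendsto_pot_of_even {x : Site} (hx : Even (x.1 + x.2)) :
    ∃ l, Tendsto (fun N => pot N x) atTop (𝓝 l) :=
  ⟨_, tendsto_atTop_ciSup (pot_mono hx) (pot_bddAbove hx)⟩

lemma tendsto_heat_sub {x : Site} (hx : Even (x.1 + x.2)) :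
    Tendsto (fun n => heat n 0 - heat n x) atTop (𝓝 0) := by
  obtain ⟨l, hl⟩ := exists_tendsto_pot_of_even hx
  have := (hl.comp (tendsto_add_atTop_nat 1)).sub hl
  rw [sub_self] at this
  refine this.congr fun n => ?_
  simp [Function.comp, pot_succ]

lemma heat_two_mul_antitone : Antitone fun m => heat (2 * m) 0 :=
  antitone_nat_of_succ_le fun m => by
    have h1 : ∀ y, heat (2 * m + 1) y ≤ heat (2 * m) 0 := fun y => by
      rw [heat_succ, ← avg_const (heat (2 * m) 0) y]
      exact avg_mono fun z _ => heat_two_mul_le m z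
    change heat (2 * m + 1 + 1) 0 ≤ _
    rw [heat_succ, ← avg_const (heat (2 * m) 0) 0]
    exact avg_mono fun z _ => h1 z

lemma tendsto_heat_two_mul : Tendsto (fun m => heat (2 * m) 0) atTop (𝓝 0) := by
  have hb : BddBelow (Set.range fun m => heat (2 * m) 0) :=
    ⟨0, by rintro _ ⟨m, rfl⟩; exact heat_nonneg _ _⟩
  have hL := tendsto_atTop_ciInf heat_two_mul_antitone hb
  set L := ⨅ m, heat (2 * m) 0 with hLdef
  have hL0 : 0 ≤ L := le_ciInf fun m => heat_nonneg _ _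
  have h2 : Tendsto (fun m : ℕ => 2 * m) atTop atTop :=
    tendsto_id.const_mul_atTop' (by norm_num)
  -- The terms of a convergent series tend to 0, so every site (2i, 0) has the same limit L. Total
  -- mass 1 then forces K L ≤ 1 for every K.
  have hx : ∀ i : ℕ, Tendsto (fun m => heat (2 * m) ((2 * i : ℤ), 0)) atTop (𝓝 L) := by
    intro i
    have h3 := hL.sub ((tendsto_heat_sub (x := ((2 * i : ℤ), 0)) (by simp)).comp h2)
    simpa [Function.comp] using h3
  have hK : ∀ K : ℕ, K * L ≤ 1 := by
    intro K
    have h4 := tendsto_finsetSum (Finset.range K) fun i _ => hx i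
    rw [Finset.sum_const, Finset.card_range, nsmul_eq_mul] at h4
    refine le_of_tendsto' h4 fun m => ?_
    have hinj : Set.InjOn (fun i : ℕ => (((2 * i : ℤ), 0) : Site)) (Finset.range K) := by
      intro i _ j _ hij
      simpa using hij
    rw [← Finset.sum_image (f := heat (2 * m)) hinj]
    exact sum_le_hasSum _ (fun z _ => heat_nonneg _ _) (hasSum_heat _)
  have : L = 0 := by
    by_contra hne
    obtain ⟨K, hK'⟩ := exists_nat_gt (1 / L)
    have hpos : 0 < L := lt_of_le_of_ne hL0 (Ne.symm hne)
    rw [div_lt_iff₀ hpos] at hK'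
    linarith [hK K]
  rwa [this] at hL

lemma tendsto_heat : Tendsto (fun n => heat n 0) atTop (𝓝 0) := by
  rw [Metric.tendsto_atTop]
  intro ε hε
  obtain ⟨M, hM⟩ := (Metric.tendsto_atTop.1 tendsto_heat_two_mul) ε hε
  refine ⟨2 * M, fun n hn => ?_⟩
  by_cases h : Even n
  · obtain ⟨m, rfl⟩ := h
    rw [← two_mul]
    exact hM m (by omega)
  · rw [heat_odd_eq_zero h (by simp), dist_self]
    exact hε

lemma odd_nbr {x y : Site} (hx : ¬ Even (x.1 + x.2)) (h : Nbr x y) : Even (y.1 + y.2) := by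
  rw [← mem_nbrs] at h
  simp only [nbrs, Finset.mem_insert, Finset.mem_singleton] at h
  rw [Int.even_iff] at *
  rcases h with rfl | rfl | rfl | rfl <;> simp only [Prod.fst_add, Prod.snd_add] <;> omega

/-- An odd site is nonzero and has only even neighbours, so `pot_succ'` transfers their limits to
it, the extra term `heat N 0` vanishing in the limit. -/
lemma exists_tendsto_pot (x : Site) : ∃ l, Tendsto (fun N => pot N x) atTop (𝓝 l) := by
  by_cases hx : Even (x.1 + x.2)
  · exact exists_tendsto_pot_of_even hx
  · have h : ∀ y, ∃ l, Nbr x y → Tendsto (fun N => pot N y) atTop (𝓝 l) := fun y => by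
      by_cases hy : Nbr x y
      · obtain ⟨l, hl⟩ := exists_tendsto_pot_of_even (odd_nbr hx hy)
        exact ⟨l, fun _ => hl⟩
      · exact ⟨0, fun H => absurd H hy⟩
    choose g hg using h
    refine ⟨0 + avg g x, (tendsto_add_atTop_iff_nat 1).1 ?_⟩
    have hx0 : x ≠ 0 := by
      rintro rfl
      simp at hx
    simp only [pot_succ' _ hx0]
    exact tendsto_heat.add (tendsto_avg hg)

/-! ### Divergence of Green's function -/

lemma avg_normSq (x : Site) :
    avg (fun z => (z.1 : ℝ) ^ 2 + (z.2 : ℝ) ^ 2) x = (x.1 : ℝ) ^ 2 + (x.2 : ℝ) ^ 2 + 1 := by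
  simp only [avg, Prod.fst_add, Prod.snd_add]
  push_cast
  ring

lemma hasSum_heat_mul_normSq (n : ℕ) :
    HasSum (fun z => heat n z * ((z.1 : ℝ) ^ 2 + (z.2 : ℝ) ^ 2)) n := by
  have h := hasSum_heat_mul n (fun z => (z.1 : ℝ) ^ 2 + (z.2 : ℝ) ^ 2) 0
  have h2 : ∀ n : ℕ, ∀ x, avg^[n] (fun z : Site => (z.1 : ℝ) ^ 2 + (z.2 : ℝ) ^ 2) x =
      (x.1 : ℝ) ^ 2 + (x.2 : ℝ) ^ 2 + n := by
    intro n
    induction n with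
    | zero => simp
    | succ n ih =>
      intro x
      rw [Function.iterate_succ_apply', avg_congr fun y _ => ih y, avg_add, avg_normSq, avg_const]
      push_cast
      ring
  rw [h2] at h
  simpa using h

/-- Chebyshev: E|S_{2m}|² = 2m, so 1 - |S_{2m}|²/(4m) has mean 1/2 and is positive only inside a box
of (2r + 1)² ≤ 9r² ≤ 36m sites, each of probability at most `heat (2 * m) 0`. Hence the constant 72.
-/
lemma heat_two_mul_lower (m : ℕ) (hm : 1 ≤ m) : 1 / (72 * (m : ℝ)) ≤ heat (2 * m) 0 := by
  have hm' : (1 : ℝ) ≤ m := by exact_mod_cast hm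
  set r : ℕ := Nat.sqrt (4 * m)
  set B : Finset Site := Finset.Icc (-(r : ℤ)) r ×ˢ Finset.Icc (-(r : ℤ)) r
  have hB : ∀ z : Site, z ∉ B → (4 * m : ℝ) ≤ (z.1 : ℝ) ^ 2 + (z.2 : ℝ) ^ 2 := by
    intro z hz
    by_contra! hlt
    have key : ∀ a b : ℤ, (a : ℝ) ^ 2 + (b : ℝ) ^ 2 < 4 * m → a ∈ Finset.Icc (-(r : ℤ)) r := by
      intro a b hab
      have h1 : (a : ℝ) ^ 2 < 4 * m := by nlinarith [sq_nonneg (b : ℝ)]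
      have h2 : a ^ 2 < 4 * m := by exact_mod_cast h1
      have h3 : a.natAbs * a.natAbs ≤ 4 * m := by
        zify
        rw [← sq, sq_abs]
        exact h2.le
      have h4 := Nat.le_sqrt.2 h3
      rw [Finset.mem_Icc]
      omega
    exact hz (Finset.mem_product.2 ⟨key _ _ hlt, key _ _ (by rwa [add_comm])⟩)
  have h1 : HasSum (fun z : Site => heat (2 * m) z * (1 - ((z.1 : ℝ) ^ 2 + (z.2 : ℝ) ^ 2) / (4 * m)))
      (1 / 2) := by
    have h := (hasSum_heat (2 * m)).sub ((hasSum_heat_mul_normSq (2 * m)).div_const (4 * m))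
    have e : 1 - ((2 * m : ℕ) : ℝ) / (4 * m) = 1 / 2 := by
      push_cast
      field_simp
      norm_num
    rw [e] at h
    exact h.congr_fun fun z => by ring
  have h2 : HasSum (fun z => if z ∈ B then heat (2 * m) 0 else 0) (∑ z ∈ B, heat (2 * m) 0) := by
    have := hasSum_sum_of_ne_finset_zero (L := .unconditional _) (f := fun z => if z ∈ B then heat (2 * m) 0 else 0)
      (s := B) fun z hz => if_neg hz
    rwa [Finset.sum_congr rfl fun z hz => if_pos hz] at this
  have h3 := hasSum_le (fun z => ?_) h1 h2
  · rw [Finset.sum_const, nsmul_eq_mul] at h3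
    have hr : r * r ≤ 4 * m := Nat.sqrt_le (4 * m)
    have hr2 : 1 ≤ r := Nat.le_sqrt.2 (by omega)
    have hcard : B.card = (2 * r + 1) * (2 * r + 1) := by
      rw [Finset.card_product, Int.card_Icc]
      congr 1 <;> omega
    have hcard' : (B.card : ℝ) ≤ 36 * m := by
      rw [hcard]
      have : (2 * r + 1) * (2 * r + 1) ≤ 36 * m := by nlinarith
      exact_mod_cast this
    rw [div_le_iff₀ (by positivity)]
    nlinarith [heat_nonneg (2 * m) 0, mul_le_mul_of_nonneg_right hcard' (heat_nonneg (2 * m) 0)]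
  · have hz0 := heat_nonneg (2 * m) z
    split_ifs with hz
    · refine le_trans (mul_le_of_le_one_right hz0 ?_) (heat_two_mul_le m z)
      have : 0 ≤ ((z.1 : ℝ) ^ 2 + (z.2 : ℝ) ^ 2) / (4 * m) := by positivity
      linarith
    · refine mul_nonpos_of_nonneg_of_nonpos hz0 ?_
      have : 1 ≤ ((z.1 : ℝ) ^ 2 + (z.2 : ℝ) ^ 2) / (4 * m) := by
        rw [le_div_iff₀ (by positivity), one_mul]
        exact hB z hz
      linarith

lemma exists_le_green (C : ℝ) : ∃ N, C ≤ green N 0 := by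
  have h1 : ∀ M : ℕ, (1 / 72) * ∑ i ∈ Finset.range M, 1 / ((i : ℝ) + 1) ≤ green (2 * M + 2) 0 := by
    intro M
    induction M with
    | zero =>
      simp only [Finset.range_zero, Finset.sum_empty, mul_zero]
      exact Finset.sum_nonneg fun n _ => heat_nonneg n 0
    | succ M ih =>
      rw [Finset.sum_range_succ, mul_add]
      have h2 := heat_two_mul_lower (M + 1) (by omega)
      have h3 : green (2 * (M + 1) + 2) 0 = green (2 * M + 2) 0 + heat (2 * (M + 1)) 0 +
          heat (2 * (M + 1) + 1) 0 := by
        rw [green_succ, green_succ]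
        rfl
      have h4 : (1 / 72) * (1 / ((M : ℝ) + 1)) = 1 / (72 * ((M + 1 : ℕ) : ℝ)) := by
        push_cast
        field_simp
      rw [h3, h4]
      linarith [heat_nonneg (2 * (M + 1) + 1) 0]
  obtain ⟨M, hM⟩ := (Real.tendsto_sum_range_one_div_nat_succ_atTop.eventually_ge_atTop
    (72 * C)).exists
  exact ⟨2 * M + 2, by linarith [h1 M]⟩

/-! ### The potential kernel -/

lemma chainLaw_real_eq_one (p : Site → Site → ℝ) {x : Site} {E : Set Path}
    (h : ∀ S : Path, S 0 = x → S ∈ E) : (chainLaw p x).real E = 1 := by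
  have h1 : E =ᵐ[chainLaw p x] Set.univ := by
    filter_upwards [ae_start p x] with S hS
    exact eq_true (h S hS)
  rw [measureReal_congr h1, probReal_univ]

lemma chainLaw_real_eq_zero (p : Site → Site → ℝ) {x : Site} {E : Set Path}
    (h : ∀ S : Path, S 0 = x → S ∉ E) : (chainLaw p x).real E = 0 := by
  have h1 : E =ᵐ[chainLaw p x] (∅ : Set Path) := by
    filter_upwards [ae_start p x] with S hS
    exact eq_false (h S hS)
  rw [measureReal_congr h1, measureReal_empty]

lemma srwLaw_real_eval (n : ℕ) (x y : Site) :
    (srwLaw x).real {S : Path | S n = y} = heat n (x - y) := by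
  induction n generalizing x with
  | zero =>
    rw [heat_zero]
    split_ifs with h
    · exact chainLaw_real_eq_one _ fun S hS => hS.trans (sub_eq_zero.1 h)
    · exact chainLaw_real_eq_zero _ fun S hS hSy => h (sub_eq_zero.2 (hS.symm.trans hSy))
  | succ n ih =>
    have hm : MeasurableSet {S : Path | S (n + 1) = y} :=
      measurableSet_eq_fun (measurable_pi_apply (n + 1)) measurable_const
    rw [srwLaw_real x hm, heat_succ, ← avg_comp_sub]
    exact avg_congr fun z _ => ih z

lemma potentialPartialSum_eq (x : Site) (N : ℕ) : potentialPartialSum x N = pot N x := by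
  rw [potentialPartialSum, pot_eq_sum]
  refine Finset.sum_congr rfl fun n _ => ?_
  rw [srwLaw_real_eval, srwLaw_real_eval, sub_zero, zero_sub, heat_neg]

lemma tendsto_potentialPartialSum (x : Site) :
    Tendsto (potentialPartialSum x) atTop (𝓝 (potentialKernel x)) := by
  obtain ⟨l, hl⟩ := exists_tendsto_pot x
  exact tendsto_nhds_limUnder ⟨l, hl.congr fun N => (potentialPartialSum_eq x N).symm⟩

lemma tendsto_pot (x : Site) : Tendsto (fun N => pot N x) atTop (𝓝 (potentialKernel x)) :=
  (tendsto_potentialPartialSum x).congr (potentialPartialSum_eq x)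

lemma potentialKernel_zero : potentialKernel 0 = 0 :=
  tendsto_nhds_unique (tendsto_pot 0) (by simp [pot])

lemma avg_potentialKernel {x : Site} (hx : x ≠ 0) :
    avg potentialKernel x = potentialKernel x := by
  have h1 := (tendsto_add_atTop_iff_nat 1).2 (tendsto_pot x)
  simp only [pot_succ' _ hx] at h1
  have h2 := tendsto_heat.add (tendsto_avg (x := x) fun y _ => tendsto_pot y)
  rw [zero_add] at h2
  exact tendsto_nhds_unique h2 h1

lemma pot_le_potentialKernel (N : ℕ) {x : Site} (hx : Even (x.1 + x.2)) :
    pot N x ≤ potentialKernel x :=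
  (pot_mono hx).ge_of_tendsto (tendsto_pot x) N

lemma one_le_potentialKernel {x : Site} (hx : Even (x.1 + x.2)) (h0 : x ≠ 0) :
    1 ≤ potentialKernel x := by
  -- The time-0 term alone contributes 1.
  refine le_trans (le_of_eq ?_) (pot_le_potentialKernel 1 hx)
  simp [pot, green, heat_zero, h0]

lemma potentialKernel_nonneg_of_even {x : Site} (hx : Even (x.1 + x.2)) :
    0 ≤ potentialKernel x :=
  (pot_nonneg 0 hx).trans (pot_le_potentialKernel 0 hx)

lemma potentialKernel_pos {x : Site} (h0 : x ≠ 0) : 0 < potentialKernel x := by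
  by_cases hx : Even (x.1 + x.2)
  · exact one_pos.trans_le (one_le_potentialKernel hx h0)
  · rw [← avg_potentialKernel h0, avg_eq_sum]
    have hn : ∀ y ∈ nbrs x, 0 ≤ potentialKernel y := fun y hy =>
      potentialKernel_nonneg_of_even (odd_nbr hx (mem_nbrs.1 hy))
    obtain ⟨y, hy, hy0⟩ : ∃ y ∈ nbrs x, y ≠ 0 := by
      by_contra! H
      have h1 := H (x + (1, 0)) (by simp [nbrs])
      have h2 := H (x + (-1, 0)) (by simp [nbrs])
      have h3 := congrArg Prod.fst (h1.trans h2.symm)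
      simp only [Prod.fst_add] at h3
      omega
    have h1 := Finset.single_le_sum hn hy
    have h2 := one_le_potentialKernel (odd_nbr hx (mem_nbrs.1 hy)) hy0
    linarith

lemma potentialKernel_nonneg (x : Site) : 0 ≤ potentialKernel x := by
  by_cases hx : x = 0
  · rw [hx, potentialKernel_zero]
  · exact (potentialKernel_pos hx).le

lemma isStochasticRow_potentialKernel {x : Site} (hx : x ≠ 0) :
    IsStochasticRow (doobStep potentialKernel) x :=
  isStochasticRow_doobStep (potentialKernel_pos hx) (fun y _ => potentialKernel_nonneg y)
    (avg_potentialKernel hx)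

/-- The walk needs at least |x₁| + |x₂| steps to reach x. For a distant even site `green N x`
therefore vanishes, and a(x) is at least `green N 0`, which is arbitrarily large. -/
lemma finite_potentialKernel_le (C : ℝ) : {x | potentialKernel x ≤ C}.Finite := by
  obtain ⟨N, hN⟩ := exists_le_green (C + 1)
  have h1 : ∀ x : Site, Even (x.1 + x.2) → (N : ℤ) ≤ |x.1| + |x.2| →
      C + 1 ≤ potentialKernel x := by
    intro x hx hxN
    refine le_trans ?_ (pot_le_potentialKernel N hx)
    have : green N x = 0 := Finset.sum_eq_zero fun n hn =>
      heat_eq_zero_of_lt (by have := Finset.mem_range.1 hn; omega)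
    rw [pot, this]
    linarith
  refine (Finset.finite_toSet (Finset.Icc (-(N : ℤ)) N ×ˢ Finset.Icc (-(N : ℤ)) N)).subset ?_
  intro x hx
  change potentialKernel x ≤ C at hx
  by_contra hB
  -- The extra 1 keeps the neighbours of an odd site at ℓ¹ distance at least `N`, where `h1`
  -- applies.
  have hfar : (N : ℤ) + 1 ≤ |x.1| + |x.2| := by
    rw [Finset.mem_coe, Finset.mem_product, Finset.mem_Icc, Finset.mem_Icc] at hB
    simp only [abs_eq_max_neg]
    omega
  by_cases he : Even (x.1 + x.2)
  · linarith [h1 x he (by omega)]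
  · have h0 : x ≠ 0 := by
      rintro rfl
      simp at he
    have : avg (fun _ => C + 1) x ≤ avg potentialKernel x := by
      refine avg_mono fun y hy => h1 y (odd_nbr he hy) ?_
      rw [← mem_nbrs] at hy
      simp only [nbrs, Finset.mem_insert, Finset.mem_singleton] at hy
      simp only [abs_eq_max_neg] at hfar ⊢
      rcases hy with rfl | rfl | rfl | rfl <;> simp only [Prod.fst_add, Prod.snd_add] <;> omega
    rw [avg_const, avg_potentialKernel h0] at this
    linarith

/-- Minimum principle on the complement of `A`. -/
lemma nonneg_of_superharmonic {A : Set Site} {f : Site → ℝ} (hA : ∀ x ∈ A, 0 ≤ f x)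
    (hf : ∀ x ∉ A, avg f x ≤ f x) (hfin : {x | f x < 0}.Finite) (x : Site) : 0 ≤ f x := by
  by_contra! hx
  obtain ⟨z, hz, hmin⟩ := Set.exists_min_image _ f hfin ⟨x, hx⟩
  change f z < 0 at hz
  have hmin' : ∀ y, f z ≤ f y := fun y => by
    by_cases hy : f y < 0
    · exact hmin y hy
    · exact hz.le.trans (not_lt.1 hy)
  have hM : {y | f y = f z}.Finite := hfin.subset fun y (hy : f y = f z) => by
    change f y < 0
    rwa [hy]
  -- At a rightmost minimiser, superharmonicity forces the right-hand neighbour to be a minimiser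
  -- too, a contradiction.
  obtain ⟨w, hw, hmax⟩ := Set.exists_max_image _ Prod.fst hM ⟨z, rfl⟩
  change f w = f z at hw
  have hwA : w ∉ A := fun h => by linarith [hA w h]
  have h1 := hf w hwA
  have h2 : f (w + (1, 0)) = f z := by
    unfold avg at h1
    linarith [hmin' (w + (1, 0)), hmin' (w + (-1, 0)), hmin' (w + (0, 1)), hmin' (w + (0, -1))]
  have h3 := hmax (w + (1, 0)) h2
  simp only [Prod.fst_add] at h3
  omega

/-! ### Hitting times -/

/-- The trajectories that never hit `A`. -/
def avoid (A : Finset Site) : Set Path := {S | ∀ n, S n ∉ A}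

lemma setOf_hitTime_eq_top (A : Finset Site) : {S | hitTime A S = ⊤} = avoid A := by
  ext S
  simp [hitTime, avoid, hittingAfter_eq_top_iff]

lemma measurableSet_eval_mem (n : ℕ) (A : Set Site) : MeasurableSet {S : Path | S n ∈ A} :=
  measurable_pi_apply n A.to_countable.measurableSet

lemma measurableSet_avoid (A : Finset Site) : MeasurableSet (avoid A) := by
  have : avoid A = ⋂ n, {S : Path | S n ∈ A}ᶜ := by
    ext S; simp [avoid]
  rw [this]
  exact MeasurableSet.iInter fun n => (measurableSet_eval_mem n A).compl

lemma pathCons_preimage_avoid {A : Finset Site} {x : Site} (hx : x ∉ A) :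
    pathCons x ⁻¹' avoid A = avoid A := by
  ext S
  refine ⟨fun h n => h (n + 1), fun h n => ?_⟩
  cases n with
  | zero => exact hx
  | succ n => exact h n

lemma chainLaw_avoid_of_mem (p : Site → Site → ℝ) {A : Finset Site} {x : Site} (hx : x ∈ A) :
    (chainLaw p x).real (avoid A) = 0 :=
  chainLaw_real_eq_zero p fun _ hS h => h 0 (hS ▸ hx)

/-- Here a serves as a Lyapunov function. The avoidance probability is harmonic off A and bounded,
and a has finite sublevel sets, so the minimum principle gives P_x[avoid] ≤ ε a(x) for every ε > 0.
-/
lemma srwLaw_avoid {A : Finset Site} (hA : (0 : Site) ∈ A) (x : Site) :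
    (srwLaw x).real (avoid A) = 0 := by
  refine le_antisymm ?_ measureReal_nonneg
  have key : ∀ ε : ℝ, 0 < ε → (srwLaw x).real (avoid A) ≤ ε * potentialKernel x := by
    intro ε hε
    have := nonneg_of_superharmonic (A := A)
      (f := fun y => ε * potentialKernel y - (srwLaw y).real (avoid A)) ?_ ?_ ?_ x
    · linarith
    · intro y hy
      rw [srwLaw, chainLaw_avoid_of_mem _ hy, sub_zero]
      exact mul_nonneg hε.le (potentialKernel_nonneg y)
    · intro y hy
      have hy0 : y ≠ 0 := fun h => hy (h ▸ hA)
      rw [avg_sub, avg_const_mul, avg_potentialKernel hy0,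
        srwLaw_real y (measurableSet_avoid A), pathCons_preimage_avoid hy]
    · refine (finite_potentialKernel_le (1 / ε)).subset fun y hy => ?_
      change ε * potentialKernel y - (srwLaw y).real (avoid A) < 0 at hy
      change potentialKernel y ≤ 1 / ε
      rw [le_div_iff₀ hε]
      linarith [measureReal_le_one (μ := srwLaw y) (s := avoid A)]
  have h := ((continuous_id.mul continuous_const).tendsto (0 : ℝ)).mono_left
    (nhdsWithin_le_nhds (s := Set.Ioi (0 : ℝ))) (f := fun ε : ℝ => ε * potentialKernel x)
  have h2 : (srwLaw x).real (avoid A) ≤ id 0 * potentialKernel x :=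
    ge_of_tendsto h (eventually_nhdsWithin_of_forall fun ε hε => key ε hε)
  simpa using h2

lemma ae_hitTime_ne_top {A : Finset Site} (hA : (0 : Site) ∈ A) (x : Site) :
    ∀ᵐ S ∂(srwLaw x), hitTime A S ≠ ⊤ := by
  rw [ae_iff]
  simp only [ne_eq, not_not]
  rw [setOf_hitTime_eq_top]
  exact (measureReal_eq_zero_iff).1 (srwLaw_avoid hA x)

/-- The trajectories that hit `A` by time `n`. -/
def hitBy (A : Finset Site) (n : ℕ) : Set Path := {S | ∃ i ≤ n, S i ∈ A}

/-- The trajectories that hit `A` by time `n`, and do so first at the point `y`. -/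
def hitAt (A : Finset Site) (y : Site) (n : ℕ) : Set Path :=
  {S | ∃ i ≤ n, (∀ j < i, S j ∉ A) ∧ S i = y}

lemma hitBy_mono (A : Finset Site) : Monotone (hitBy A) :=
  fun _ _ hmn _ ⟨i, hi, h⟩ => ⟨i, hi.trans hmn, h⟩

lemma hitAt_mono (A : Finset Site) (y : Site) : Monotone (hitAt A y) :=
  fun _ _ hmn _ ⟨i, hi, h⟩ => ⟨i, hi.trans hmn, h⟩

lemma measurableSet_hitBy (A : Finset Site) (n : ℕ) : MeasurableSet (hitBy A n) := by
  have : hitBy A n = ⋃ i, ⋃ _ : i ≤ n, {S : Path | S i ∈ A} := by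
    ext S; simp [hitBy]
  rw [this]
  exact MeasurableSet.iUnion fun i => MeasurableSet.iUnion fun _ => measurableSet_eval_mem i A

lemma measurableSet_hitAt (A : Finset Site) (y : Site) (n : ℕ) : MeasurableSet (hitAt A y n) := by
  have : hitAt A y n = ⋃ i, ⋃ _ : i ≤ n,
      (⋂ j, ⋂ _ : j < i, {S : Path | S j ∈ A}ᶜ) ∩ {S : Path | S i ∈ ({y} : Set Site)} := by
    ext S; simp [hitAt, and_left_comm]
  rw [this]
  exact MeasurableSet.iUnion fun i => MeasurableSet.iUnion fun _ =>
    (MeasurableSet.iInter fun j => MeasurableSet.iInter fun _ =>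
      (measurableSet_eval_mem j A).compl).inter (measurableSet_eval_mem i {y})

lemma pathCons_preimage_hitBy {A : Finset Site} {x : Site} (hx : x ∉ A) (n : ℕ) :
    pathCons x ⁻¹' hitBy A (n + 1) = hitBy A n := by
  ext S
  constructor
  · rintro ⟨_ | i, hi, h⟩
    · exact absurd h hx
    · exact ⟨i, by omega, h⟩
  · rintro ⟨i, hi, h⟩
    exact ⟨i + 1, by omega, h⟩

lemma pathCons_preimage_hitAt {A : Finset Site} {x y : Site} (hx : x ∉ A) (hy : y ∈ A) (n : ℕ) :
    pathCons x ⁻¹' hitAt A y (n + 1) = hitAt A y n := by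
  ext S
  constructor
  · rintro ⟨_ | i, hi, h1, h2⟩
    · exact absurd (by rwa [← h2] at hy) hx
    · exact ⟨i, by omega, fun j hj => h1 (j + 1) (by omega), h2⟩
  · rintro ⟨i, hi, h1, h2⟩
    refine ⟨i + 1, by omega, fun j hj => ?_, h2⟩
    cases j with
    | zero => exact hx
    | succ j => exact h1 j (by omega)

lemma tendsto_measureReal_iUnion {μ : Measure Path} [IsFiniteMeasure μ] {E : ℕ → Set Path}
    (hE : Monotone E) : Tendsto (fun n => μ.real (E n)) atTop (𝓝 (μ.real (⋃ n, E n))) :=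
  (ENNReal.tendsto_toReal (measure_ne_top μ _)).comp (tendsto_measure_iUnion_atTop hE)

lemma mul_condLaw_hitBy_of_mem {A : Finset Site} (n : ℕ) {x : Site} (hx : x ∈ A) :
    potentialKernel x * (condLaw x).real (hitBy A n) =
      ∑ y ∈ A, potentialKernel y * (srwLaw x).real (hitAt A y n) := by
  have h1 : (condLaw x).real (hitBy A n) = 1 :=
    chainLaw_real_eq_one _ fun S hS => ⟨0, Nat.zero_le n, hS ▸ hx⟩
  have h2 : (srwLaw x).real (hitAt A x n) = 1 :=
    chainLaw_real_eq_one _ fun S hS => ⟨0, Nat.zero_le n, by simp, hS⟩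
  rw [h1, Finset.sum_eq_single_of_mem x hx, h2]
  intro y hy hyx
  rw [srwLaw, chainLaw_real_eq_zero, mul_zero]
  rintro S hS ⟨i, hi, h1, h2⟩
  rcases Nat.eq_zero_or_pos i with rfl | h
  · exact hyx (h2.symm.trans hS)
  · exact h1 0 h (hS ▸ hx)

/-- Off A, each side at time n + 1 is the neighbour average of itself at time n. The origin, where Ŝ
has no genuine transition row, lies in A and never enters the recursion. -/
lemma mul_condLaw_hitBy {A : Finset Site} (hA : (0 : Site) ∈ A) (n : ℕ) (x : Site) :
    potentialKernel x * (condLaw x).real (hitBy A n) =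
      ∑ y ∈ A, potentialKernel y * (srwLaw x).real (hitAt A y n) := by
  induction n generalizing x with
  | zero =>
    by_cases hx : x ∈ A
    · exact mul_condLaw_hitBy_of_mem 0 hx
    · rw [condLaw, chainLaw_real_eq_zero, mul_zero, Finset.sum_eq_zero]
      · intro y hy
        rw [srwLaw, chainLaw_real_eq_zero, mul_zero]
        rintro S hS ⟨i, hi, h1, h2⟩
        obtain rfl : i = 0 := by omega
        exact hx (by rw [← hS, h2]; exact hy)
      · rintro S hS ⟨i, hi, h⟩
        obtain rfl : i = 0 := by omega
        exact hx (hS ▸ h)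
  | succ n ih =>
    by_cases hx : x ∈ A
    · exact mul_condLaw_hitBy_of_mem _ hx
    have hx0 : x ≠ 0 := fun h => hx (h ▸ hA)
    have hstep : ∀ y ∈ A, potentialKernel y * (srwLaw x).real (hitAt A y (n + 1)) =
        avg (fun z => potentialKernel y * (srwLaw z).real (hitAt A y n)) x := by
      intro y hy
      rw [srwLaw_real x (measurableSet_hitAt A y (n + 1)), pathCons_preimage_hitAt hx hy,
        avg_const_mul]
    rw [Finset.sum_congr rfl hstep, ← avg_sum, condLaw,
      chainLaw_doobStep_real (isStochasticRow_potentialKernel hx0) (measurableSet_hitBy A _),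
      pathCons_preimage_hitBy hx, mul_div_cancel₀ _ (potentialKernel_pos hx0).ne']
    exact avg_congr fun y _ => ih y

lemma stoppedValue_eq {A : Finset Site} {S : Path} {i : ℕ} {y : Site} (hy : y ∈ A)
    (h1 : ∀ j < i, S j ∉ A) (h2 : S i = y) :
    stoppedValue (fun (n : ℕ) (S : Path) => S n) (hitTime A) S = y := by
  have h3 : hitTime A S ≤ i := hittingAfter_le_of_mem (Nat.zero_le i) (by simpa [h2] using hy)
  have h4 : (i : WithTop ℕ) ≤ hitTime A S := by
    by_contra! h
    obtain ⟨j, hj, hjA⟩ := (hittingAfter_lt_iff).1 h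
    exact h1 j hj.2 hjA
  rw [stoppedValue, le_antisymm h3 h4]
  exact h2

lemma mem_iUnion_hitAt {A : Finset Site} {S : Path} (hS : hitTime A S ≠ ⊤) :
    ∃ y ∈ A, S ∈ ⋃ n, hitAt A y n := by
  classical
  have h : ∃ n, S n ∈ A := by
    by_contra! H
    exact hS (by rw [← Set.mem_ofPred_eq (p := fun S => hitTime A S = ⊤), setOf_hitTime_eq_top]
                 exact H)
  exact ⟨S (Nat.find h), Nat.find_spec h, Set.mem_iUnion.2
    ⟨Nat.find h, Nat.find h, le_rfl, fun j hj => Nat.find_min h hj, rfl⟩⟩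

lemma integral_potentialKernel_stoppedValue {A : Finset Site} (hA : (0 : Site) ∈ A) (x : Site) :
    ∫ S, potentialKernel (stoppedValue (fun (n : ℕ) (S : Path) => S n) (hitTime A) S)
        ∂(srwLaw x) =
      ∑ y ∈ A, potentialKernel y * (srwLaw x).real (⋃ n, hitAt A y n) := by
  have hm : ∀ y, MeasurableSet (⋃ n, hitAt A y n) := fun y =>
    MeasurableSet.iUnion fun n => measurableSet_hitAt A y n
  have h1 : ∀ᵐ S ∂(srwLaw x),
      potentialKernel (stoppedValue (fun (n : ℕ) (S : Path) => S n) (hitTime A) S) =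
        ∑ y ∈ A, (⋃ n, hitAt A y n).indicator (fun _ => potentialKernel y) S := by
    -- Recurrence makes the value of `stoppedValue` at time `⊤` irrelevant; for finite hitting times
    -- exactly one indicator is nonzero.
    filter_upwards [ae_hitTime_ne_top hA x] with S hS
    have hval : ∀ y ∈ A, S ∈ ⋃ n, hitAt A y n →
        stoppedValue (fun (n : ℕ) (S : Path) => S n) (hitTime A) S = y := by
      intro y hy hSy
      obtain ⟨n, i, -, h1, h2⟩ := Set.mem_iUnion.1 hSy
      exact stoppedValue_eq hy h1 h2
    obtain ⟨y, hy, hSy⟩ := mem_iUnion_hitAt hS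
    rw [Finset.sum_eq_single_of_mem y hy, Set.indicator_of_mem hSy, hval y hy hSy]
    intro z hz hzy
    exact Set.indicator_of_notMem (fun h => hzy ((hval z hz h).symm.trans (hval y hy hSy))) _
  rw [integral_congr_ae h1, integral_finsetSum]
  · refine Finset.sum_congr rfl fun y _ => ?_
    rw [integral_indicator_const _ (hm y), smul_eq_mul, mul_comm]
  · intro y _
    exact (integrable_const _).indicator (hm y)

lemma compl_avoid (A : Finset Site) : (avoid A)ᶜ = ⋃ n, hitBy A n := by
  ext S
  simp only [avoid, hitBy, Set.mem_compl_iff, Set.mem_ofPred_eq, Set.mem_iUnion, not_forall,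
    not_not]
  exact ⟨fun ⟨n, h⟩ => ⟨n, n, le_rfl, h⟩, fun ⟨_, i, _, h⟩ => ⟨i, h⟩⟩

/-- `q_A = a · ℙ̂[τ̂_A = ∞]`. -/
lemma qFun_eq {A : Finset Site} (hA : (0 : Site) ∈ A) (x : Site) :
    qFun A x = potentialKernel x * (condLaw x).real (avoid A) := by
  have h1 : Tendsto (fun n => potentialKernel x * (condLaw x).real (hitBy A n)) atTop
      (𝓝 (potentialKernel x * (condLaw x).real (avoid A)ᶜ)) := by
    rw [compl_avoid]
    exact (tendsto_measureReal_iUnion (hitBy_mono A)).const_mul _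
  simp only [mul_condLaw_hitBy hA] at h1
  have h2 : Tendsto (fun n => ∑ y ∈ A, potentialKernel y * (srwLaw x).real (hitAt A y n)) atTop
      (𝓝 (∑ y ∈ A, potentialKernel y * (srwLaw x).real (⋃ n, hitAt A y n))) :=
    tendsto_finsetSum _ fun y _ => (tendsto_measureReal_iUnion (hitAt_mono A y)).const_mul _
  rw [qFun, integral_potentialKernel_stoppedValue hA, ← tendsto_nhds_unique h1 h2,
    probReal_compl_eq_one_sub (measurableSet_avoid A)]
  ring

/-! ### The conditioned walk -/

lemma qFun_nonneg {A : Finset Site} (hA : (0 : Site) ∈ A) (x : Site) : 0 ≤ qFun A x := by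
  rw [qFun_eq hA]
  exact mul_nonneg (potentialKernel_nonneg x) measureReal_nonneg

lemma qFun_of_mem {A : Finset Site} (hA : (0 : Site) ∈ A) {x : Site} (hx : x ∈ A) :
    qFun A x = 0 := by
  rw [qFun_eq hA, condLaw, chainLaw_avoid_of_mem _ hx, mul_zero]

lemma avg_qFun {A : Finset Site} (hA : (0 : Site) ∈ A) {x : Site} (hx : x ∉ A) :
    avg (qFun A) x = qFun A x := by
  have hx0 : x ≠ 0 := fun h => hx (h ▸ hA)
  rw [avg_congr fun y _ => qFun_eq hA y, qFun_eq hA, condLaw,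
    chainLaw_doobStep_real (isStochasticRow_potentialKernel hx0) (measurableSet_avoid A),
    pathCons_preimage_avoid hx, mul_div_cancel₀ _ (potentialKernel_pos hx0).ne']
  rfl

/-- Since A is finite, q_A differs from a by a bounded amount, so q_A > 0 far away. -/
lemma potentialKernel_sub_le_qFun {A : Finset Site} (hA : (0 : Site) ∈ A) (x : Site) :
    potentialKernel x - ∑ y ∈ A, potentialKernel y ≤ qFun A x := by
  rw [qFun, integral_potentialKernel_stoppedValue hA]
  exact sub_le_sub_left (Finset.sum_le_sum fun y _ =>
    mul_le_of_le_one_right (potentialKernel_nonneg y) measureReal_le_one) _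

/-- An infinite component contains a site where a exceeds its sum over A, so q_A > 0 there.
Harmonicity and nonnegativity carry positivity back along the path to `x`. -/
lemma qFun_pos {A : Finset Site} (hA : (0 : Site) ∈ A) {x : Site}
    (hx : InInfiniteComponent A x) : 0 < qFun A x := by
  obtain ⟨hxA, hinf⟩ := hx
  obtain ⟨y, hy, hyC⟩ :=
    hinf.exists_notMem_finite (finite_potentialKernel_le (∑ y ∈ A, potentialKernel y))
  have hqy : 0 < qFun A y := by
    have h1 := potentialKernel_sub_le_qFun hA y
    have h2 : ∑ y ∈ A, potentialKernel y < potentialKernel y := not_le.1 hyC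
    linarith
  clear hinf
  change Relation.ReflTransGen _ x y at hy
  revert hxA
  induction hy using Relation.ReflTransGen.head_induction_on with
  | refl => exact fun _ => hqy
  | head huv _ ih =>
    intro huA
    rw [← avg_qFun hA huA, avg_eq_sum]
    have := Finset.single_le_sum (f := qFun A) (fun z _ => qFun_nonneg hA z)
      (mem_nbrs.2 huv.1)
    linarith [ih huv.2]

lemma isStochasticRow_qFun {A : Finset Site} (hA : (0 : Site) ∈ A) {x : Site}
    (hx : InInfiniteComponent A x) : IsStochasticRow (doobStep (qFun A)) x :=
  isStochasticRow_doobStep (qFun_pos hA hx) (fun y _ => qFun_nonneg hA y) (avg_qFun hA hx.1)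

lemma InInfiniteComponent.of_nbr {A : Finset Site} {x y : Site} (hx : InInfiniteComponent A x)
    (hxy : Nbr x y) (hy : y ∉ A) : InInfiniteComponent A y :=
  ⟨hy, hx.2.mono fun _ hz => Relation.ReflTransGen.head ⟨hxy.symm, hx.1⟩ hz⟩

/-- Induction on the first step: multiplied by a and by q_A respectively, both sides become
neighbour averages of the same statement for the shifted path. -/
lemma mul_condLaw_avoid_inter_cyl {A : Finset Site} (hA : (0 : Site) ∈ A) (m : ℕ) (γ : Path)
    {x : Site} (hx : InInfiniteComponent A x) :
    potentialKernel x * (condLaw x).real (avoid A ∩ cyl m γ) =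
      qFun A x * (condLawOf A x).real (cyl m γ) := by
  have hx0 : x ≠ 0 := fun h => hx.1 (h ▸ hA)
  by_cases hγ : γ 0 = x
  · induction m generalizing γ x with
    | zero =>
      have h1 : (condLawOf A x).real (cyl 0 γ) = 1 := by
        refine chainLaw_real_eq_one _ fun S hS i hi => ?_
        rw [Nat.le_zero.1 hi, hS, hγ]
      have h2 : (avoid A ∩ cyl 0 γ : Set Path) =ᵐ[condLaw x] avoid A := by
        filter_upwards [ae_start (doobStep potentialKernel) x] with S hS
        refine propext ⟨fun h => h.1, fun h => ⟨h, fun i hi => ?_⟩⟩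
        rw [Nat.le_zero.1 hi, hS, hγ]
      rw [h1, mul_one, qFun_eq hA, measureReal_congr h2]
    | succ m ih =>
      rw [condLaw, condLawOf,
        chainLaw_doobStep_real (isStochasticRow_potentialKernel hx0)
          ((measurableSet_avoid A).inter (measurableSet_cyl _ γ)),
        chainLaw_doobStep_real (isStochasticRow_qFun hA hx) (measurableSet_cyl _ γ),
        Set.preimage_inter, pathCons_preimage_avoid hx.1, pathCons_preimage_cyl_succ, if_pos hγ,
        mul_div_cancel₀ _ (potentialKernel_pos hx0).ne', mul_div_cancel₀ _ (qFun_pos hA hx).ne']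
      refine avg_congr fun y hy => ?_
      by_cases hyA : y ∈ A
      · rw [qFun_of_mem hA hyA, zero_mul, chainLaw_real_eq_zero, mul_zero]
        exact fun S hS h => h.1 0 (hS ▸ hyA)
      · by_cases hγ1 : γ 1 = y
        · exact ih (fun i => γ (i + 1)) (hx.of_nbr hy hyA) (fun h => hyA (h ▸ hA)) hγ1
        · rw [chainLaw_real_eq_zero, chainLaw_real_eq_zero, mul_zero, mul_zero]
          · exact fun S hS h => hγ1 ((h 0 (Nat.zero_le _)).symm.trans hS)
          · exact fun S hS h => hγ1 ((h.2 0 (Nat.zero_le _)).symm.trans hS)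
  · rw [condLaw, condLawOf, chainLaw_real_eq_zero, chainLaw_real_eq_zero, mul_zero, mul_zero]
    · exact fun S hS h => hγ ((h 0 (Nat.zero_le _)).symm.trans hS)
    · exact fun S hS h => hγ ((h.2 0 (Nat.zero_le _)).symm.trans hS)

instance (A : Finset Site) (x : Site) : IsProbabilityMeasure (condLawOf A x) := by
  unfold condLawOf; infer_instance

lemma condLaw_avoid {A : Finset Site} (hA : (0 : Site) ∈ A) {x : Site} (hx : x ∉ A) :
    (condLaw x).real (avoid A) = qFun A x / potentialKernel x := by
  have hx0 : x ≠ 0 := fun h => hx (h ▸ hA)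
  rw [qFun_eq hA, mul_div_cancel_left₀ _ (potentialKernel_pos hx0).ne']

lemma condLaw_avoid_pos {A : Finset Site} (hA : (0 : Site) ∈ A) {x : Site}
    (hx : InInfiniteComponent A x) : 0 < (condLaw x).real (avoid A) := by
  rw [condLaw_avoid hA hx.1]
  exact div_pos (qFun_pos hA hx) (potentialKernel_pos fun h => hx.1 (h ▸ hA))

/-- The walk conditioned on avoiding `A` is the Doob transform with respect to `q_A`. -/
lemma cond_condLaw_avoid {A : Finset Site} (hA : (0 : Site) ∈ A) {x : Site}
    (hx : InInfiniteComponent A x) : (condLaw x)[|avoid A] = condLawOf A x := by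
  have ha : 0 < potentialKernel x := potentialKernel_pos fun h => hx.1 (h ▸ hA)
  have hq := qFun_pos hA hx
  refine ext_of_cyl fun m γ => ?_
  rw [← ENNReal.toReal_eq_toReal_iff' (measure_ne_top _ _) (measure_ne_top _ _),
    cond_apply (measurableSet_avoid A), ENNReal.toReal_mul, ENNReal.toReal_inv]
  change ((condLaw x).real (avoid A))⁻¹ * (condLaw x).real (avoid A ∩ cyl m γ) =
    (condLawOf A x).real (cyl m γ)
  rw [condLaw_avoid hA hx.1, inv_div, div_mul_eq_mul_div, mul_condLaw_avoid_inter_cyl hA m γ hx,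
    mul_div_cancel_left₀ _ hq.ne']

end CondWalk

end

open CondWalk in
theorem lemma1p2 (A : Finset Site) (hA : (0 : Site) ∈ A) :
    -- the objects are well defined
    ((∀ x, Tendsto (potentialPartialSum x) atTop (𝓝 (potentialKernel x))) ∧
      (∀ x, x ≠ 0 → 0 < potentialKernel x ∧ IsStochasticRow (doobStep potentialKernel) x) ∧
      (∀ x, ∀ᵐ S ∂(srwLaw x), hitTime A S ≠ ⊤) ∧
      (∀ x, InInfiniteComponent A x →
        0 < qFun A x ∧ IsStochasticRow (doobStep (qFun A)) x)) ∧
    -- the probability that `Ŝ` never hits `A`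
    (∀ x₀, x₀ ∉ A →
      (condLaw x₀).real {S | hitTime A S = ⊤} = qFun A x₀ / potentialKernel x₀) ∧
    -- `Ŝ` conditioned on never hitting `A` is `Ŝ^{(A)}`
    (∀ x₀, InInfiniteComponent A x₀ →
      0 < (condLaw x₀).real {S | hitTime A S = ⊤} ∧
      (∀ (m : ℕ) (γ : ℕ → Site), γ 0 = x₀ → (∀ i < m, Nbr (γ i) (γ (i + 1))) →
        (∀ i ≤ m, γ i ∉ A) →
        ((condLaw x₀)[|{S | hitTime A S = ⊤}]).real {S | ∀ i, 1 ≤ i → i ≤ m → S i = γ i} =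
          (condLawOf A x₀).real {S | ∀ i, 1 ≤ i → i ≤ m → S i = γ i}) ∧
      (condLaw x₀)[|{S | hitTime A S = ⊤}] = condLawOf A x₀) := by
  refine ⟨⟨tendsto_potentialPartialSum,
    fun x hx => ⟨potentialKernel_pos hx, isStochasticRow_potentialKernel hx⟩,
    ae_hitTime_ne_top hA, fun x hx => ⟨qFun_pos hA hx, isStochasticRow_qFun hA hx⟩⟩, ?_, ?_⟩
  · intro x₀ hx₀
    rw [setOf_hitTime_eq_top, condLaw_avoid hA hx₀]
  · intro x₀ hx₀
    rw [setOf_hitTime_eq_top, cond_condLaw_avoid hA hx₀]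
    exact ⟨condLaw_avoid_pos hA hx₀, fun _ _ _ _ _ => rfl, rfl⟩
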